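/- Let $\gamma\subset\mathbb R^2$ be an oval, that is, a smooth simple closed plane curve with everywhere positive curvature, oriented counterclockwise. The outer length billiard map $F$ of $\gamma$ is defined on the exterior of $\gamma$ as follows. For a point $A$ outside $\gamma$ let $Ax'$ and $Ax$ be the two tangent segments from $A$ to $\gamma$, where at $x'$ the vector $\overrightarrow{Ax'}$ has the direction of the orientation of $\gamma$, and at $x$ the vector $\overrightarrow{Ax}$ has the opposite direction. Consider the circle that is tangent to $\gamma$ at $x'$, is tangent to the line $Ax$, and lies on the right of the ray $Ax'$. Then $F(A)$ is the intersection point of the line $Ax'$ with the common tangent line of this circle and $\gamma$ that differs from the lines $Ax'$ and $Ax$. For every oval $\gamma$ and every positive integer $k$ there is a constant $\rho=\rho(k,\gamma)>0$ such that no $k$-periodic orbit of $F$ has a point outside the origin-centered disc of radius $\rho$; that is, if $F^k(z)=z$, then $|z|\le\rho$. -/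

import Mathlib

open scoped ContDiff

/-- The Euclidean plane. -/
abbrev Plane : Type := EuclideanSpace ℝ (Fin 2)

/-- The oriented area `det (u, v)`; it is positive iff `v` points to the left of `u`, and negative
iff `v` points to the right of `u`. -/
def cross (u v : Plane) : ℝ := u 0 * v 1 - u 1 * v 0

/-- `γ` is an `L`-periodic parametrization of an oval: a smooth simple closed plane curve that is
quadratically convex, i.e. whose curvature `det (γ', γ'') / ‖γ'‖ ^ 3` is everywhere positive
(in particular `γ'` never vanishes). A positive signed curvature means that the oval is oriented
counterclockwise, i.e. has its interior on the left. -/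
structure IsOval (γ : ℝ → Plane) (L : ℝ) : Prop where
  period_pos : 0 < L
  smooth : ContDiff ℝ ∞ γ
  periodic : Function.Periodic γ L
  simple : Set.InjOn γ (Set.Ico 0 L)
  curvature_pos : ∀ t, 0 < cross (deriv γ t) (deriv (deriv γ) t)

/-- The exterior of an oval: the complement of the closed convex region that it bounds. -/
def exterior (γ : ℝ → Plane) : Set Plane := (convexHull ℝ (Set.range γ))ᶜ

/-- The tangent line of `γ` at the point `γ t`. -/
noncomputable def tangentLine (γ : ℝ → Plane) (t : ℝ) : AffineSubspace ℝ Plane :=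
  AffineSubspace.mk' (γ t) (Submodule.span ℝ {deriv γ t})

/-- The segment from `A` to `γ t` is the positive tangent segment: it is tangent to the curve, and
travelled from `A` to `γ t` it has the direction of the curve. -/
def IsPositiveTangentSegment (γ : ℝ → Plane) (A : Plane) (t : ℝ) : Prop :=
  ∃ b : ℝ, 0 < b ∧ γ t - A = b • deriv γ t

/-- The segment from `A` to `γ t` is the negative tangent segment: it is tangent to the curve, and
travelled from `A` to `γ t` it has the direction opposite to that of the curve. -/
def IsNegativeTangentSegment (γ : ℝ → Plane) (A : Plane) (t : ℝ) : Prop :=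
  ∃ a : ℝ, 0 < a ∧ γ t - A = -(a • deriv γ t)

/-- `S` is the auxiliary circle of the point `A`, whose positive and negative tangent segments end
at `γ x'` and `γ x`: it is tangent to the curve at `γ x'`, it is tangent to the line through `A`
and `γ x`, and it lies on the right of the ray from `A` through `γ x'`. (Being tangent to this ray,
it lies on the side of its centre; as the centre is not on the ray, its radius is positive.) -/
structure IsAuxiliaryCircle (γ : ℝ → Plane) (A : Plane) (x x' : ℝ)
    (S : EuclideanGeometry.Sphere Plane) : Prop where
  tangent_curve : S.IsTangentAt (γ x') (tangentLine γ x')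
  tangent_line : S.IsTangent (tangentLine γ x)
  right_side : cross (γ x' - A) (S.center - A) < 0

/-- The graph `F(A) = A'` of the outer length billiard map `F` of the curve `γ`. Let `A` be a point
outside the oval with positive tangent segment from `A` to `γ x'` and negative tangent segment from
`A` to `γ x`, and let `S` be its auxiliary circle. Then `A'` is the point where the line through
`A` and `γ x'` meets the common tangent line of `S` and of the curve (say, at `γ x''`) that is
neither the line through `A` and `γ x'` nor the line through `A` and `γ x`. -/
def OuterLengthBilliard (γ : ℝ → Plane) (A A' : Plane) : Prop :=
  A ∈ exterior γ ∧
  ∃ (x x' x'' : ℝ) (S : EuclideanGeometry.Sphere Plane),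
    IsNegativeTangentSegment γ A x ∧
    IsPositiveTangentSegment γ A x' ∧
    IsAuxiliaryCircle γ A x x' S ∧
    S.IsTangent (tangentLine γ x'') ∧
    tangentLine γ x'' ≠ tangentLine γ x' ∧
    tangentLine γ x'' ≠ tangentLine γ x ∧
    A' ∈ tangentLine γ x' ∧
    A' ∈ tangentLine γ x''

/-- `p 0, p 1, p 2, …` is a `k`-periodic orbit of the outer length billiard map `F` of `γ`, that is,
`p (i + 1) = F (p i)` and `p (i + k) = p i` for all `i`. (The least period may be a proper divisor
of `k`.) -/
def IsPeriodicOrbit (γ : ℝ → Plane) (k : ℕ) (p : ℕ → Plane) : Prop :=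
  (∀ i, OuterLengthBilliard γ (p i) (p (i + 1))) ∧ Function.Periodic p k

/-!
The auxiliary circle of a point `A` relates two consecutive points `A`, `A'` of an orbit. Both lie on
the tangent line at `γ x'`, at distances `b` and `s` from `γ x'`; if the curve is seen from `A` under
the angle `θ` and from `A'` under the angle `θ'`, then the radius of the circle is
`b * cot (θ / 2) = s * cot (θ' / 2)` (`exists_of_outerLengthBilliard`). Here `b * sin θ` and
`s * sin θ'` are distances between points of the curve and tangent lines of the curve: they are
bounded above, and `b * sin θ` is bounded away from zero when `θ` is not obtuse. As
`cot (θ / 2) = sin θ / (1 - cos θ)`, the quantity `1 - cos θ` grows in one step at most by a constant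
factor (`IsStrictlyConvexParam.one_add_cos_le`). So an orbit that starts far away sees the curve under
angles less than `π / k` during its first `k` steps.

The positive tangent direction turns by `π - θ'` in one step. If the orbit is `k`-periodic, then `kπ`
minus the sum of `k` angles of vision is a multiple of `2π`, hence the sum is a multiple of `π`; but
it lies strictly between `0` and `π` (`not_closed_of_small_angles`).

This uses that the curve lies to the left of each of its tangent lines. An oval is parametrized by
the angle of its tangent (`IsOval.exists_tangentAngleParam`), which turns by `2πn` in one period. The
distances from tangent lines are controlled by the sign of the sine once `n = 1`, and for `n ≥ 2` the
curve would have a double point (`IsTangentAngleParam.turning_eq_one`). In terms of the tangent angle,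
points outside the curve are described by the direction angles `φ` and `ψ` of their negative and
positive tangent segments, and the angle of vision is `π - (ψ - φ)`.
-/

/-! ### The parametrization of an oval by its tangent angle -/

/-- The unit vector that makes the angle `θ` with the first coordinate axis. -/
noncomputable def dir (θ : ℝ) : Plane := !₂[Real.cos θ, Real.sin θ]

@[simp] lemma dir_zero (θ : ℝ) : dir θ 0 = Real.cos θ := rfl

@[simp] lemma dir_one (θ : ℝ) : dir θ 1 = Real.sin θ := rfl

lemma plane_ext {u v : Plane} (h0 : u 0 = v 0) (h1 : u 1 = v 1) : u = v := by
  ext i; fin_cases i <;> assumption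

lemma norm_sq_plane (u : Plane) : ‖u‖ ^ 2 = u 0 ^ 2 + u 1 ^ 2 := by
  simp [EuclideanSpace.norm_sq_eq, Fin.sum_univ_two]

lemma hasDerivAt_apply {f : ℝ → Plane} {v : Plane} {t : ℝ} (h : HasDerivAt f v t) (i : Fin 2) :
    HasDerivAt (fun s => f s i) (v i) t :=
  (EuclideanSpace.proj (𝕜 := ℝ) i).hasFDerivAt.comp_hasDerivAt t h

/-- `β` parametrizes a closed curve by the angle of its tangent, which turns by `2πn` in total; the
curve is simple, and it has positive curvature (`‖β'‖` is the radius of curvature). -/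
structure IsTangentAngleParam (β : ℝ → Plane) (n : ℕ) : Prop where
  pos : 0 < n
  hasDeriv : ∀ θ, ∃ r : ℝ, 0 < r ∧ HasDerivAt β (r • dir θ) θ
  periodic : Function.Periodic β (n * (2 * Real.pi))
  simple : ∀ s t, β s = β t → ∃ j : ℤ, t = s + j * (n * (2 * Real.pi))

/-- A non-vanishing planar velocity field with positive curvature has a continuous angle, obtained
as the imaginary part of `∫ z' / z`. -/
lemma exists_angle {V W : ℝ → Plane} (hV : ∀ t, HasDerivAt V (W t) t) (hW : Continuous W)
    (hpos : ∀ t, 0 < cross (V t) (W t)) :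
    ∃ α α' : ℝ → ℝ, (∀ t, HasDerivAt α (α' t) t) ∧ (∀ t, 0 < α' t) ∧
      (∀ t, α' t = cross (V t) (W t) / (V t 0 ^ 2 + V t 1 ^ 2)) ∧
      ∀ t, ∃ c : ℝ, 0 < c ∧ V t = c • dir (α t) := by
  set z : ℝ → ℂ := fun t => (V t 0 : ℂ) + (V t 1 : ℂ) * Complex.I with hz
  set z' : ℝ → ℂ := fun t => (W t 0 : ℂ) + (W t 1 : ℂ) * Complex.I with hz'
  have hdz : ∀ t, HasDerivAt z (z' t) t := fun t =>
    (hasDerivAt_apply (hV t) 0).ofReal_comp.add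
      ((hasDerivAt_apply (hV t) 1).ofReal_comp.mul_const Complex.I)
  have hz0 : ∀ t, z t ≠ 0 := by
    intro t h
    have h0 : V t 0 = 0 := by simpa [hz] using congrArg Complex.re h
    have h1 : V t 1 = 0 := by simpa [hz] using congrArg Complex.im h
    have := hpos t
    simp [cross, h0, h1] at this
  have hcz : Continuous z := continuous_iff_continuousAt.2 fun t => (hdz t).continuousAt
  have hcz' : Continuous z' := by
    have := (EuclideanSpace.proj (𝕜 := ℝ) (0 : Fin 2)).continuous.comp hW
    have := (EuclideanSpace.proj (𝕜 := ℝ) (1 : Fin 2)).continuous.comp hW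
    fun_prop
  have hcq : Continuous fun t => z' t / z t := hcz'.div hcz hz0
  set w : ℝ → ℂ := fun t => Complex.log (z 0) + ∫ s in (0 : ℝ)..t, z' s / z s with hw
  have hdw : ∀ t, HasDerivAt w (z' t / z t) t := fun t =>
    (intervalIntegral.integral_hasDerivAt_right (hcq.intervalIntegrable _ _)
      (hcq.stronglyMeasurableAtFilter _ _) hcq.continuousAt).const_add _
  have hexp : ∀ t, z t = Complex.exp (w t) := by
    have hd : ∀ t, HasDerivAt (fun s => z s * Complex.exp (-w s)) 0 t := by
      intro t
      refine ((hdz t).mul ((hdw t).fun_neg.cexp)).congr_deriv ?_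
      have := hz0 t
      field_simp
      ring
    intro t
    have h1 : z t * Complex.exp (-w t) = z 0 * Complex.exp (-w 0) :=
      is_const_of_deriv_eq_zero (fun s => (hd s).differentiableAt) (fun s => (hd s).deriv) t 0
    have h2 : w 0 = Complex.log (z 0) := by simp [hw]
    rw [h2, Complex.exp_neg, Complex.exp_neg, Complex.exp_log (hz0 0), mul_inv_cancel₀ (hz0 0)] at h1
    exact (mul_inv_eq_one₀ (Complex.exp_ne_zero _)).1 h1
  have him : ∀ t, (z' t / z t).im = cross (V t) (W t) / (V t 0 ^ 2 + V t 1 ^ 2) := by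
    intro t
    simp only [Complex.div_im, Complex.normSq_apply, hz, hz', cross]
    simp
    ring
  have hnpos : ∀ t, 0 < V t 0 ^ 2 + V t 1 ^ 2 := by
    intro t
    rcases (by positivity : 0 ≤ V t 0 ^ 2 + V t 1 ^ 2).eq_or_lt with h | h
    · have h0 : V t 0 = 0 := by nlinarith [sq_nonneg (V t 0), sq_nonneg (V t 1)]
      have h1 : V t 1 = 0 := by nlinarith [sq_nonneg (V t 0), sq_nonneg (V t 1)]
      have := hpos t
      simp [cross, h0, h1] at this
    · exact h
  refine ⟨fun t => (w t).im, fun t => (z' t / z t).im, fun t => ?_, fun t => ?_, him, fun t => ?_⟩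
  · exact Complex.imCLM.hasFDerivAt.comp_hasDerivAt t (hdw t)
  · change 0 < (z' t / z t).im
    rw [him]; exact div_pos (hpos t) (hnpos t)
  · refine ⟨Real.exp (w t).re, Real.exp_pos _, plane_ext ?_ ?_⟩
    · have := congrArg Complex.re (hexp t)
      simpa [hz, Complex.exp_re] using this
    · have := congrArg Complex.im (hexp t)
      simpa [hz, Complex.exp_im] using this

lemma dir_eq_of_smul_eq {a b : ℝ} (ha : 0 < a) (hb : 0 < b) {s t : ℝ}
    (h : a • dir s = b • dir t) : (s : Real.Angle) = t := by
  have h0 : a * Real.cos s = b * Real.cos t := by simpa using congrFun (congrArg WithLp.ofLp h) 0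
  have h1 : a * Real.sin s = b * Real.sin t := by simpa using congrFun (congrArg WithLp.ofLp h) 1
  have hab : a = b := by
    have : a ^ 2 = b ^ 2 := by
      have e1 := Real.sin_sq_add_cos_sq s
      have e2 := Real.sin_sq_add_cos_sq t
      calc a ^ 2 = (a * Real.cos s) ^ 2 + (a * Real.sin s) ^ 2 := by linear_combination -a ^ 2 * e1
        _ = b ^ 2 := by rw [h0, h1]; linear_combination b ^ 2 * e2
    exact (pow_left_inj₀ ha.le hb.le two_ne_zero).1 this
  subst hab
  exact Real.Angle.cos_sin_inj (mul_left_cancel₀ ha.ne' h0) (mul_left_cancel₀ ha.ne' h1)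

/-- An oval is parametrized by its tangent angle. -/
lemma IsOval.exists_tangentAngleParam {γ : ℝ → Plane} {L : ℝ} (hγ : IsOval γ L) :
    ∃ (α : ℝ → ℝ) (β : ℝ → Plane) (n : ℕ), (∀ t, γ t = β (α t)) ∧
      (∀ t, ∃ c : ℝ, 0 < c ∧ deriv γ t = c • dir (α t)) ∧ IsTangentAngleParam β n := by
  have hL := hγ.period_pos
  have hγ1 : ∀ t, HasDerivAt γ (deriv γ t) t := fun t =>
    (hγ.smooth.differentiable (by simp)).differentiableAt.hasDerivAt
  have hs1 : ContDiff ℝ ∞ (deriv γ) := (contDiff_infty_iff_deriv.1 hγ.smooth).2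
  have hγ2 : ∀ t, HasDerivAt (deriv γ) (deriv (deriv γ) t) t := fun t =>
    (hs1.differentiable (by simp)).differentiableAt.hasDerivAt
  have hc2 : Continuous (deriv (deriv γ)) := (contDiff_infty_iff_deriv.1 hs1).2.continuous
  obtain ⟨α, α', hα, hα'pos, hα', hdir⟩ := exists_angle hγ2 hc2 hγ.curvature_pos
  have hperV : Function.Periodic (deriv γ) L := by
    intro t
    rw [← deriv_comp_add_const]
    exact congrArg (fun f => deriv f t) (funext hγ.periodic)
  have hperW : Function.Periodic (deriv (deriv γ)) L := by
    intro t
    rw [← deriv_comp_add_const]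
    exact congrArg (fun f => deriv f t) (funext hperV)
  have hmono : StrictMono α := strictMono_of_deriv_pos fun t => by
    rw [(hα t).deriv]; exact hα'pos t
  have hαc : Continuous α := continuous_iff_continuousAt.2 fun t => (hα t).continuousAt
  have hturn : ∀ t, α (t + L) - α t = α (0 + L) - α 0 := by
    intro t
    have hd : ∀ s, HasDerivAt (fun s => α (s + L) - α s) 0 s := by
      intro s
      refine (((hα (s + L)).comp_add_const s L).sub (hα s)).congr_deriv ?_
      rw [hα', hα', hperV, hperW, sub_self]
    exact is_const_of_deriv_eq_zero (fun s => (hd s).differentiableAt) (fun s => (hd s).deriv) t 0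
  obtain ⟨n, hn0, hn⟩ : ∃ n : ℕ, 0 < n ∧ ∀ t, α (t + L) = α t + n * (2 * Real.pi) := by
    obtain ⟨c, hc, hcV⟩ := hdir (0 + L)
    obtain ⟨d, hd, hdV⟩ := hdir 0
    rw [hperV, hdV] at hcV
    obtain ⟨k, hk⟩ := Real.Angle.angle_eq_iff_two_pi_dvd_sub.1 (dir_eq_of_smul_eq hd hc hcV).symm
    have hpos : 0 < α (0 + L) - α 0 := sub_pos.2 (hmono (by linarith))
    have hk0 : 0 < k := by
      rw [hk] at hpos
      exact_mod_cast (pos_iff_pos_of_mul_pos hpos).1 Real.two_pi_pos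
    refine ⟨k.toNat, by omega, fun t => ?_⟩
    have hkc : ((k.toNat : ℕ) : ℝ) = k := by exact_mod_cast Int.toNat_of_nonneg hk0.le
    rw [hkc]
    linarith [hturn t]
  have hN : 0 < (n : ℝ) * (2 * Real.pi) := by have := Real.pi_pos; positivity
  have hint : ∀ (j : ℤ) t, α (t + j * L) = α t + j * (n * (2 * Real.pi)) := by
    intro j
    induction j using Int.induction_on with
    | zero => intro t; simp
    | succ i ih =>
      intro t
      have := hn (t + i * L)
      have h2 := ih t
      push_cast at h2 ⊢
      rw [show t + ((i : ℝ) + 1) * L = t + i * L + L by ring, this, h2]; ring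
    | pred i ih =>
      intro t
      have := hn (t + (-(i : ℝ) - 1) * L)
      have h2 := ih t
      push_cast at h2 ⊢
      rw [show t + (-(i : ℝ) - 1) * L + L = t + -i * L by ring, h2] at this
      linarith
  have hsurj : Function.Surjective α := by
    refine hαc.surjective (Filter.tendsto_atTop_atTop_of_monotone hmono.monotone fun b => ?_)
      (Filter.tendsto_atBot_atBot_of_monotone hmono.monotone fun b => ?_)
    · obtain ⟨m, hm⟩ := exists_nat_gt ((b - α 0) / (n * (2 * Real.pi)))
      refine ⟨0 + (m : ℤ) * L, ?_⟩
      rw [hint]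
      rw [div_lt_iff₀ hN] at hm
      push_cast
      linarith
    · obtain ⟨m, hm⟩ := exists_nat_gt ((α 0 - b) / (n * (2 * Real.pi)))
      refine ⟨0 + ((-m : ℤ) : ℝ) * L, ?_⟩
      rw [hint]
      rw [div_lt_iff₀ hN] at hm
      push_cast
      linarith
  let e : ℝ ≃o ℝ := hmono.orderIsoOfSurjective α hsurj
  have he : ∀ t, e t = α t := fun t => rfl
  have hes : ∀ θ, α (e.symm θ) = θ := fun θ => e.apply_symm_apply θ
  refine ⟨α, fun θ => γ (e.symm θ), n, fun t => ?_, hdir, hn0, fun θ => ?_, fun θ => ?_,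
    fun s t hst => ?_⟩
  · exact congrArg γ (e.symm_apply_apply t).symm
  · have h1 : HasDerivAt e.symm (α' (e.symm θ))⁻¹ θ :=
      HasDerivAt.of_local_left_inverse e.symm.continuous.continuousAt (hα _) (hα'pos _).ne'
        (Filter.Eventually.of_forall hes)
    obtain ⟨c, hc, hcV⟩ := hdir (e.symm θ)
    refine ⟨(α' (e.symm θ))⁻¹ * c, mul_pos (inv_pos.2 (hα'pos _)) hc, ?_⟩
    have h2 := (hγ1 (e.symm θ)).scomp θ h1
    rw [hcV, smul_smul, hes] at h2
    exact h2
  · have : e.symm (θ + n * (2 * Real.pi)) = e.symm θ + L := by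
      rw [e.symm_apply_eq, he, hn, hes]
    simp only [this, hγ.periodic (e.symm θ)]
  · have hmod : ∀ u : ℝ, ∃ j : ℤ, u + j * L ∈ Set.Ico 0 L := by
      intro u
      obtain ⟨j, hj, -⟩ := existsUnique_add_zsmul_mem_Ico hL u 0
      exact ⟨j, by simpa using hj⟩
    obtain ⟨i, hi⟩ := hmod (e.symm s)
    obtain ⟨j, hj⟩ := hmod (e.symm t)
    have hij : e.symm s + i * L = e.symm t + j * L := by
      apply hγ.simple hi hj
      have p1 := hγ.periodic.int_mul i (e.symm s)
      have p2 := hγ.periodic.int_mul j (e.symm t)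
      rw [p1, p2]; exact hst
    refine ⟨i - j, ?_⟩
    have h1 := congrArg α hij
    rw [hint, hint, hes, hes] at h1
    push_cast
    linarith

/-! ### A simple closed curve with positive curvature turns only once -/

namespace IsTangentAngleParam

variable {β : ℝ → Plane} {n : ℕ}

lemma continuous (hβ : IsTangentAngleParam β n) : Continuous β :=
  continuous_iff_continuousAt.2 fun θ => by
    obtain ⟨r, -, hr⟩ := hβ.hasDeriv θ
    exact hr.continuousAt

lemma hasDerivAt_cross (hβ : IsTangentAngleParam β n) (θ : ℝ) (A : Plane) (s : ℝ) :
    ∃ r : ℝ, 0 < r ∧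
      HasDerivAt (fun s => cross (dir θ) (β s - A)) (r * Real.sin (s - θ)) s := by
  obtain ⟨r, hr, h⟩ := hβ.hasDeriv s
  refine ⟨r, hr, ?_⟩
  have h0 := (hasDerivAt_apply h 0).sub_const (A 0)
  have h1 := (hasDerivAt_apply h 1).sub_const (A 1)
  refine ((h1.const_mul (Real.cos θ)).sub (h0.const_mul (Real.sin θ))).congr_deriv ?_
  simp [Real.sin_sub]
  ring

lemma continuous_cross (hβ : IsTangentAngleParam β n) (θ : ℝ) (A : Plane) :
    Continuous fun s => cross (dir θ) (β s - A) :=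
  continuous_iff_continuousAt.2 fun s => by
    obtain ⟨r, -, hr⟩ := hβ.hasDerivAt_cross θ A s
    exact hr.continuousAt

lemma strictMonoOn_cross (hβ : IsTangentAngleParam β n) (θ : ℝ) (A : Plane) :
    StrictMonoOn (fun s => cross (dir θ) (β s - A)) (Set.Icc θ (θ + Real.pi)) := by
  refine strictMonoOn_of_deriv_pos (convex_Icc _ _) (hβ.continuous_cross θ A).continuousOn
    fun s hs => ?_
  rw [interior_Icc] at hs
  obtain ⟨r, hr, h⟩ := hβ.hasDerivAt_cross θ A s
  rw [h.deriv]
  exact mul_pos hr (Real.sin_pos_of_pos_of_lt_pi (by linarith [hs.1]) (by linarith [hs.2]))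

lemma strictAntiOn_cross (hβ : IsTangentAngleParam β n) (θ : ℝ) (A : Plane) :
    StrictAntiOn (fun s => cross (dir θ) (β s - A))
      (Set.Icc (θ + Real.pi) (θ + 2 * Real.pi)) := by
  refine strictAntiOn_of_deriv_neg (convex_Icc _ _) (hβ.continuous_cross θ A).continuousOn
    fun s hs => ?_
  rw [interior_Icc] at hs
  obtain ⟨r, hr, h⟩ := hβ.hasDerivAt_cross θ A s
  rw [h.deriv]
  refine mul_neg_of_pos_of_neg hr ?_
  rw [← Real.sin_sub_two_pi]
  exact Real.sin_neg_of_neg_of_neg_pi_lt (by linarith [hs.2]) (by linarith [hs.1])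

end IsTangentAngleParam

/-- A strictly increasing continuous function on an interval has a continuous right inverse. -/
lemma StrictMonoOn.exists_continuousOn_rightInverse {f : ℝ → ℝ} {a b : ℝ} (hab : a ≤ b)
    (hf : ContinuousOn f (Set.Icc a b)) (hm : StrictMonoOn f (Set.Icc a b)) :
    ∃ g : ℝ → ℝ, ContinuousOn g (Set.Icc (f a) (f b)) ∧
      ∀ y ∈ Set.Icc (f a) (f b), g y ∈ Set.Icc a b ∧ f (g y) = y := by
  have hex : ∀ y ∈ Set.Icc (f a) (f b), ∃ x ∈ Set.Icc a b, f x = y :=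
    fun y hy => intermediate_value_Icc hab hf hy
  choose! g hg hfg using hex
  refine ⟨g, ?_, fun y hy => ⟨hg y hy, hfg y hy⟩⟩
  have hcomp : IsCompact (Set.Icc a b) := isCompact_Icc
  rw [continuousOn_iff_isClosed]
  intro t ht
  refine ⟨f '' (t ∩ Set.Icc a b), ?_, ?_⟩
  · exact ((hcomp.inter_left ht).image_of_continuousOn
      (hf.mono Set.inter_subset_right)).isClosed
  · ext y
    constructor
    · rintro ⟨h1, h2⟩
      exact ⟨⟨g y, ⟨h1, hg y h2⟩, hfg y h2⟩, h2⟩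
    · rintro ⟨⟨x, ⟨hxt, hx⟩, rfl⟩, h2⟩
      refine ⟨?_, h2⟩
      have := hm.injOn (hg _ h2) hx (hfg _ h2)
      simpa [this] using hxt

lemma eq_of_cross_dir_eq {θ : ℝ} {u v : Plane} (h1 : cross (dir θ) u = cross (dir θ) v)
    (h2 : cross (dir (θ - Real.pi / 2)) u = cross (dir (θ - Real.pi / 2)) v) : u = v := by
  simp only [cross, dir_zero, dir_one, Real.cos_sub_pi_div_two, Real.sin_sub_pi_div_two] at h1 h2
  have e := Real.sin_sq_add_cos_sq θ
  apply plane_ext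
  · linear_combination Real.cos θ * h2 - Real.sin θ * h1 - (u 0 - v 0) * e
  · linear_combination Real.sin θ * h2 + Real.cos θ * h1 - (u 1 - v 1) * e

namespace IsTangentAngleParam

variable {β : ℝ → Plane} {n : ℕ}

/-- If the curve returns to the tangent line at `β θ` after one full turn, ahead of `β θ`, then the
two half-turns in between cross: the first one is to the left of the second one on the tangent
line, and to the right of it near the opposite extreme. -/
lemma exists_crossing (hβ : IsTangentAngleParam β n) {θ c : ℝ} (hc : 0 < c)
    (h : β (θ + 2 * Real.pi) - β θ = c • dir θ) :
    ∃ s t, s < t ∧ t < s + 2 * Real.pi ∧ β s = β t := by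
  have hπ := Real.pi_pos
  set Y : ℝ → ℝ := fun s => cross (dir θ) (β s - β θ) with hY
  set X : ℝ → ℝ := fun s => cross (dir (θ - Real.pi / 2)) (β s - β θ) with hX
  have hYc : Continuous Y := hβ.continuous_cross _ _
  have hXc : Continuous X := hβ.continuous_cross _ _
  have hY0 : Y θ = 0 := by simp [hY, cross]
  have hX0 : X θ = 0 := by simp [hX, cross]
  have hY2 : Y (θ + 2 * Real.pi) = 0 := by
    simp only [hY, h]; simp [cross]; ring
  have hX2 : X (θ + 2 * Real.pi) = c := by
    simp only [hX, h]
    simp [cross, Real.sin_sub_pi_div_two, Real.cos_sub_pi_div_two]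
    linear_combination c * Real.sin_sq_add_cos_sq θ
  have hYm : StrictMonoOn Y (Set.Icc θ (θ + Real.pi)) := hβ.strictMonoOn_cross _ _
  have hYa : StrictAntiOn Y (Set.Icc (θ + Real.pi) (θ + 2 * Real.pi)) := hβ.strictAntiOn_cross _ _
  have hXa : StrictAntiOn X (Set.Icc (θ + Real.pi / 2) (θ + 3 * Real.pi / 2)) := by
    have := hβ.strictAntiOn_cross (θ - Real.pi / 2) (β θ)
    convert this using 2 <;> ring
  obtain ⟨g, hgc, hg⟩ := hYm.exists_continuousOn_rightInverse (by linarith) hYc.continuousOn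
  have hYm' : StrictMonoOn (fun s => Y (-s))
      (Set.Icc (-(θ + 2 * Real.pi)) (-(θ + Real.pi))) := by
    intro s hs t ht hst
    exact hYa ⟨by linarith [ht.2], by linarith [ht.1]⟩ ⟨by linarith [hs.2], by linarith [hs.1]⟩
      (neg_lt_neg hst)
  obtain ⟨k, hkc, hk⟩ := hYm'.exists_continuousOn_rightInverse (by linarith)
    (show Continuous fun s => Y (-s) from hYc.comp continuous_neg).continuousOn
  simp only [neg_neg, hY0, hY2] at hgc hg hkc hk
  set H := Y (θ + Real.pi) with hH
  have hH1 : Y (θ + Real.pi / 2) < H :=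
    hYm ⟨by linarith, by linarith⟩ ⟨by linarith, by linarith⟩ (by linarith)
  have hH2 : Y (θ + 3 * Real.pi / 2) < H :=
    hYa ⟨by linarith, by linarith⟩ ⟨by linarith, by linarith⟩ (by linarith)
  have hH3 : 0 < Y (θ + Real.pi / 2) := by
    rw [← hY0]
    exact hYm ⟨by linarith, by linarith⟩ ⟨by linarith, by linarith⟩ (by linarith)
  obtain ⟨y₁, hy₁, hy₁H⟩ := exists_between (max_lt hH1 hH2)
  obtain ⟨hy1, hy2⟩ := max_lt_iff.1 hy₁
  have hy₁m : y₁ ∈ Set.Icc 0 H := ⟨by linarith, hy₁H.le⟩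
  have h0m : (0 : ℝ) ∈ Set.Icc 0 H := ⟨le_rfl, by linarith⟩
  -- The horizontal distance of the two half-turns at height `y`.
  set D : ℝ → ℝ := fun y => X (-k y) - X (g y) with hD
  have hDc : ContinuousOn D (Set.Icc 0 y₁) := by
    have hsub : Set.Icc 0 y₁ ⊆ Set.Icc 0 H := Set.Icc_subset_Icc_right hy₁H.le
    exact (hXc.comp_continuousOn (hkc.mono hsub).neg).sub (hXc.comp_continuousOn (hgc.mono hsub))
  have hD0 : 0 ≤ D 0 := by
    have e1 : g 0 = θ := hYm.injOn (hg 0 h0m).1 ⟨le_rfl, by linarith⟩ ((hg 0 h0m).2.trans hY0.symm)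
    have e2 : k 0 = -(θ + 2 * Real.pi) := by
      refine hYm'.injOn (hk 0 h0m).1 ⟨le_rfl, by linarith⟩ ((hk 0 h0m).2.trans ?_)
      simp [hY2]
    simp only [hD, e1, e2, neg_neg, hX2, hX0]
    linarith
  have hD1 : D y₁ ≤ 0 := by
    obtain ⟨⟨a1, a2⟩, a3⟩ := hg y₁ hy₁m
    obtain ⟨⟨b1, b2⟩, b3⟩ := hk y₁ hy₁m
    have c1 : θ + Real.pi / 2 ≤ g y₁ := by
      by_contra! hlt
      have := hYm ⟨a1, a2⟩ ⟨by linarith, by linarith⟩ hlt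
      linarith
    have c2 : -k y₁ ≤ θ + 3 * Real.pi / 2 := by
      by_contra! hlt
      have := hYa ⟨by linarith, by linarith⟩ ⟨by linarith, by linarith⟩ hlt
      linarith
    have := hXa.antitoneOn ⟨c1, by linarith⟩ ⟨by linarith, c2⟩ (show g y₁ ≤ -k y₁ by linarith)
    simp only [hD]
    linarith
  obtain ⟨y, hy, hyD⟩ := intermediate_value_Icc' (by linarith : (0 : ℝ) ≤ y₁) hDc ⟨hD1, hD0⟩
  have hyH : y < H := hy.2.trans_lt hy₁H
  obtain ⟨⟨a1, a2⟩, a3⟩ := hg y ⟨hy.1, hyH.le⟩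
  obtain ⟨⟨b1, b2⟩, b3⟩ := hk y ⟨hy.1, hyH.le⟩
  have a4 : g y < θ + Real.pi := by
    refine lt_of_le_of_ne a2 fun heq => ?_
    rw [heq] at a3
    linarith
  have hXeq : X (g y) = X (-k y) := by simp only [hD] at hyD; linarith
  refine ⟨g y, -k y, by linarith, ?_, ?_⟩
  · refine lt_of_le_of_ne (by linarith) fun heq => ?_
    -- Equality would force `y = 0`, where the two half-turns are at distance `c`.
    have e1 : g y = θ := by linarith
    have e2 : -k y = θ + 2 * Real.pi := by linarith
    rw [e1, e2, hX0, hX2] at hXeq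
    linarith
  · exact sub_left_injective (eq_of_cross_dir_eq (a3.trans b3.symm) hXeq)

lemma dir_add_nat_two_pi (θ : ℝ) (j : ℕ) : dir (θ + j * (2 * Real.pi)) = dir θ :=
  plane_ext (by simp [Real.cos_add_nat_mul_two_pi]) (by simp [Real.sin_add_nat_mul_two_pi])

/-- A simple closed curve with positive curvature turns by `2π`. Otherwise the signed distances
`d θ` of the points `β (θ + 2π)` from the tangent lines at `β θ` sum to zero along
`θ, θ + 2π, …`, so that `d` has a zero at which it is not increasing; there `β (θ + 2π)` is ahead of
`β θ` on their common tangent line, and the curve crosses itself. -/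
lemma turning_eq_one (hβ : IsTangentAngleParam β n) : n = 1 := by
  have hπ := Real.pi_pos
  by_contra hn
  have hn2 : 2 ≤ n := by have := hβ.pos; omega
  have hn2' : (2 : ℝ) ≤ n := by exact_mod_cast hn2
  have hsimple : ∀ s t, s < t → t < s + n * (2 * Real.pi) → β s ≠ β t := by
    intro s t hst hts heq
    obtain ⟨j, hj⟩ := hβ.simple s t heq
    have hN : 0 < (n : ℝ) * (2 * Real.pi) := by positivity
    have h1 : 0 < (j : ℝ) := by
      by_contra! hneg
      have : (j : ℝ) * (n * (2 * Real.pi)) ≤ 0 := mul_nonpos_of_nonpos_of_nonneg hneg hN.le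
      linarith
    have h2 : (j : ℝ) < 1 := by
      by_contra! hle
      have := mul_le_mul_of_nonneg_right hle hN.le
      linarith
    have h3 : 0 < j := by exact_mod_cast h1
    have h4 : j < 1 := by exact_mod_cast h2
    omega
  set d : ℝ → ℝ := fun θ => cross (dir θ) (β (θ + 2 * Real.pi) - β θ) with hd
  set d' : ℝ → ℝ := fun θ =>
    -(Real.cos θ * (β (θ + 2 * Real.pi) 0 - β θ 0)
      + Real.sin θ * (β (θ + 2 * Real.pi) 1 - β θ 1)) with hd'
  have hder : ∀ θ, HasDerivAt d (d' θ) θ := by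
    intro θ
    obtain ⟨r, -, hr⟩ := hβ.hasDeriv θ
    obtain ⟨q, -, hq⟩ := hβ.hasDeriv (θ + 2 * Real.pi)
    have hq := hq.comp_add_const θ (2 * Real.pi)
    have hD := hq.sub hr
    have h0 := hasDerivAt_apply hD 0
    have h1 := hasDerivAt_apply hD 1
    refine (((Real.hasDerivAt_cos θ).mul h1).sub ((Real.hasDerivAt_sin θ).mul h0)).congr_deriv ?_
    simp [hd']
    ring
  have hdper : Function.Periodic d (n * (2 * Real.pi)) := by
    intro θ
    simp only [hd]
    rw [dir_add_nat_two_pi, hβ.periodic θ,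
      show θ + n * (2 * Real.pi) + 2 * Real.pi = θ + 2 * Real.pi + n * (2 * Real.pi) by ring,
      hβ.periodic]
  have hsum : ∀ θ, ∑ j ∈ Finset.range n, d (θ + j * (2 * Real.pi)) = 0 := by
    intro θ
    have h1 : ∀ j : ℕ, d (θ + j * (2 * Real.pi)) =
        cross (dir θ) (β (θ + (j + 1 : ℕ) * (2 * Real.pi))) -
          cross (dir θ) (β (θ + j * (2 * Real.pi))) := by
      intro j
      simp only [hd, dir_add_nat_two_pi]
      rw [show θ + j * (2 * Real.pi) + 2 * Real.pi = θ + (j + 1 : ℕ) * (2 * Real.pi) by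
        push_cast; ring]
      simp only [cross, PiLp.sub_apply]
      ring
    rw [Finset.sum_congr rfl fun j _ => h1 j,
      Finset.sum_range_sub fun j : ℕ => cross (dir θ) (β (θ + j * (2 * Real.pi))),
      hβ.periodic]
    simp
  obtain ⟨θ, hθ, hθ'⟩ : ∃ θ, d θ = 0 ∧ d' θ ≤ 0 := by
    by_contra! hcon
    obtain ⟨a, ha⟩ : ∃ a, 0 ≤ d a := by
      by_contra! hneg
      exact (Finset.sum_neg (fun j _ => hneg _) ⟨0, Finset.mem_range.2 hβ.pos⟩).ne (hsum 0)
    have hright : ∀ x, a ≤ x → 0 ≤ d x := by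
      intro x hx
      have := image_le_of_deriv_right_lt_deriv_boundary (f := fun x => -d x)
        (f' := fun x => -d' x) (a := a) (b := x) (B := fun _ => 0) (B' := fun _ => 0)
        (fun y _ => (hder y).fun_neg.continuousAt.continuousWithinAt)
        (fun y _ => (hder y).fun_neg.hasDerivWithinAt) (by simpa using ha)
        (fun y => hasDerivAt_const _ _)
        (fun y _ hy => by simpa using hcon y (by simpa using hy)) (Set.right_mem_Icc.2 hx)
      simpa using this
    have hall : ∀ j ∈ Finset.range n, d (a + j * (2 * Real.pi)) = 0 :=
      (Finset.sum_eq_zero_iff_of_nonneg fun j _ => hright _ (by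
        have : (0 : ℝ) ≤ j * (2 * Real.pi) := by positivity
        linarith)).1 (hsum a)
    have hzero : ∀ x, a ≤ x → d x = 0 := by
      intro x hx
      have := (Finset.sum_eq_zero_iff_of_nonneg fun j (_ : j ∈ Finset.range n) =>
        hright (x + j * (2 * Real.pi)) (by
        have : (0 : ℝ) ≤ j * (2 * Real.pi) := by positivity
        linarith)).1 (hsum x) 0 (Finset.mem_range.2 hβ.pos)
      simpa using this
    have h1 := hcon (a + 1) (hzero _ (by linarith))
    have h2 : d =ᶠ[nhds (a + 1)] fun _ => 0 := by
      filter_upwards [lt_mem_nhds (show a < a + 1 by linarith)] with x hx using hzero x hx.le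
    have h3 := (hder (a + 1)).unique ((hasDerivAt_const (a + 1) (0 : ℝ)).congr_of_eventuallyEq h2)
    linarith
  have hDeq : β (θ + 2 * Real.pi) - β θ = (-d' θ) • dir θ := by
    have e := Real.sin_sq_add_cos_sq θ
    simp only [hd, cross, dir_zero, dir_one, PiLp.sub_apply] at hθ
    apply plane_ext
    · simp [hd']
      linear_combination -Real.sin θ * hθ - (β (θ + 2 * Real.pi) 0 - β θ 0) * e
    · simp [hd']
      linear_combination Real.cos θ * hθ - (β (θ + 2 * Real.pi) 1 - β θ 1) * e
  rcases hθ'.eq_or_lt with h0 | hneg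
  · rw [h0, neg_zero, zero_smul, sub_eq_zero] at hDeq
    exact hsimple θ (θ + 2 * Real.pi) (by linarith) (by nlinarith) hDeq.symm
  · obtain ⟨s, t, hst, hts, heq⟩ := hβ.exists_crossing (neg_pos.2 hneg) hDeq
    exact hsimple s t hst (by nlinarith) heq

end IsTangentAngleParam

/-! ### Strictly convex curves and their tangent segments -/

lemma cross_dir_dir (s t : ℝ) : cross (dir s) (dir t) = Real.sin (t - s) := by
  simp only [cross, dir_zero, dir_one, Real.sin_sub]; ring

lemma cross_sub (u v w : Plane) : cross u (v - w) = cross u v - cross u w := by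
  simp only [cross, PiLp.sub_apply]; ring

lemma cross_add (u v w : Plane) : cross u (v + w) = cross u v + cross u w := by
  simp only [cross, PiLp.add_apply]; ring

lemma cross_smul (u v : Plane) (c : ℝ) : cross u (c • v) = c * cross u v := by
  simp only [cross, PiLp.smul_apply, smul_eq_mul]; ring

lemma cross_smul_left (u v : Plane) (c : ℝ) : cross (c • u) v = c * cross u v := by
  simp only [cross, PiLp.smul_apply, smul_eq_mul]; ring

lemma norm_dir (θ : ℝ) : ‖dir θ‖ = 1 := by
  have : ‖dir θ‖ ^ 2 = 1 := by rw [norm_sq_plane]; simp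
  exact (pow_eq_one_iff_of_nonneg (norm_nonneg _) two_ne_zero).1 this

lemma cross_dir_le (θ : ℝ) (u : Plane) : cross (dir θ) u ≤ ‖u‖ := by
  refine abs_le_of_sq_le_sq' ?_ (norm_nonneg u) |>.2
  rw [norm_sq_plane, cross, dir_zero, dir_one]
  have e := Real.sin_sq_add_cos_sq θ
  nlinarith [sq_nonneg (Real.cos θ * u 0 + Real.sin θ * u 1), sq_nonneg (u 0), sq_nonneg (u 1)]

/-- `β` is a closed curve that is parametrized by its tangent angle and lies strictly to the left of
each of its tangent lines, apart from the point of contact. -/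
structure IsStrictlyConvexParam (β : ℝ → Plane) : Prop where
  continuous : Continuous β
  periodic : Function.Periodic β (2 * Real.pi)
  cross_pos : ∀ s t : ℝ, (s : Real.Angle) ≠ t → 0 < cross (dir s) (β t - β s)

lemma dir_congr {s t : ℝ} (h : (s : Real.Angle) = t) : dir s = dir t := by
  have h0 := congrArg Real.Angle.cos h
  have h1 := congrArg Real.Angle.sin h
  simp only [Real.Angle.cos_coe, Real.Angle.sin_coe] at h0 h1
  exact plane_ext h0 h1

lemma IsTangentAngleParam.isStrictlyConvexParam {β : ℝ → Plane} {n : ℕ}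
    (hβ : IsTangentAngleParam β n) : IsStrictlyConvexParam β := by
  have hπ := Real.pi_pos
  have hper : Function.Periodic β (2 * Real.pi) := by
    have := hβ.periodic
    rwa [hβ.turning_eq_one, Nat.cast_one, one_mul] at this
  refine ⟨hβ.continuous, hper, fun s t hst => ?_⟩
  obtain ⟨j, ⟨h1, h2⟩, -⟩ := existsUnique_add_zsmul_mem_Ico Real.two_pi_pos t s
  rw [zsmul_eq_mul] at h1 h2
  have hβt : β (t + j * (2 * Real.pi)) = β t := hper.int_mul j t
  have hne : s ≠ t + j * (2 * Real.pi) := by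
    rintro heq
    apply hst
    rw [Real.Angle.angle_eq_iff_two_pi_dvd_sub]
    exact ⟨j, by rw [heq]; ring⟩
  have h3 := lt_of_le_of_ne h1 hne
  rw [← hβt]
  set u := t + j * (2 * Real.pi)
  have h0 : cross (dir s) (β s - β s) = 0 := by simp [cross]
  rcases le_total u (s + Real.pi) with hu | hu
  · have := hβ.strictMonoOn_cross s (β s) ⟨le_rfl, by linarith⟩ ⟨h1, hu⟩ h3
    simp only [h0] at this
    exact this
  · have := hβ.strictAntiOn_cross s (β s) ⟨hu, h2.le⟩ ⟨by linarith, le_rfl⟩ h2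
    simp only [hper s, h0] at this
    exact this

/-- The point `A` is at distance `a > 0` ahead of the point of contact on the oriented tangent line
with direction angle `φ`. -/
def IsAhead (β : ℝ → Plane) (A : Plane) (φ a : ℝ) : Prop := 0 < a ∧ A = β φ + a • dir φ

/-- The point `A` is at distance `b > 0` behind the point of contact on the oriented tangent line
with direction angle `ψ`. -/
def IsBehind (β : ℝ → Plane) (A : Plane) (ψ b : ℝ) : Prop := 0 < b ∧ A = β ψ - b • dir ψ

namespace IsStrictlyConvexParam

variable {β : ℝ → Plane}

lemma congr (hβ : IsStrictlyConvexParam β) {s t : ℝ} (h : (s : Real.Angle) = t) : β s = β t := by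
  obtain ⟨k, hk⟩ := Real.Angle.angle_eq_iff_two_pi_dvd_sub.1 h
  rw [show s = t + k * (2 * Real.pi) by linear_combination hk]
  exact hβ.periodic.int_mul k t

lemma cross_nonneg (hβ : IsStrictlyConvexParam β) (s t : ℝ) :
    0 ≤ cross (dir s) (β t - β s) := by
  by_cases h : (s : Real.Angle) = t
  · rw [hβ.congr h]; simp [cross]
  · exact (hβ.cross_pos s t h).le

/-- Two tangent lines meet ahead of both contact points only if they coincide. -/
lemma isAhead_unique (hβ : IsStrictlyConvexParam β) {A : Plane} {φ φ' a a' : ℝ}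
    (h : IsAhead β A φ a) (h' : IsAhead β A φ' a') : (φ : Real.Angle) = φ' := by
  obtain ⟨ha, hA⟩ := h
  obtain ⟨ha', hA'⟩ := h'
  have h1 : β φ' - β φ = a • dir φ - a' • dir φ' := by
    rw [eq_sub_of_add_eq hA.symm, eq_sub_of_add_eq hA'.symm]; abel
  have h2 : β φ - β φ' = a' • dir φ' - a • dir φ := by rw [← neg_sub, h1]; abel
  by_contra hne
  have e1 := hβ.cross_pos φ φ' hne
  have e2 := hβ.cross_pos φ' φ (Ne.symm hne)
  rw [h1, cross_sub, cross_smul, cross_smul, cross_dir_dir, cross_dir_dir, sub_self,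
    Real.sin_zero] at e1
  rw [h2, cross_sub, cross_smul, cross_smul, cross_dir_dir, cross_dir_dir, sub_self,
    Real.sin_zero, ← neg_sub φ' φ, Real.sin_neg] at e2
  nlinarith

/-- Two tangent lines meet behind both contact points only if they coincide. -/
lemma isBehind_unique (hβ : IsStrictlyConvexParam β) {A : Plane} {ψ ψ' b b' : ℝ}
    (h : IsBehind β A ψ b) (h' : IsBehind β A ψ' b') : (ψ : Real.Angle) = ψ' := by
  obtain ⟨hb, hA⟩ := h
  obtain ⟨hb', hA'⟩ := h'
  have h1 : β ψ' - β ψ = b' • dir ψ' - b • dir ψ := by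
    rw [eq_add_of_sub_eq hA.symm, eq_add_of_sub_eq hA'.symm]; abel
  have h2 : β ψ - β ψ' = b • dir ψ - b' • dir ψ' := by rw [← neg_sub, h1]; abel
  by_contra hne
  have e1 := hβ.cross_pos ψ ψ' hne
  have e2 := hβ.cross_pos ψ' ψ (Ne.symm hne)
  rw [h1, cross_sub, cross_smul, cross_smul, cross_dir_dir, cross_dir_dir, sub_self,
    Real.sin_zero] at e1
  rw [h2, cross_sub, cross_smul, cross_smul, cross_dir_dir, cross_dir_dir, sub_self,
    Real.sin_zero, ← neg_sub ψ' ψ, Real.sin_neg] at e2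
  nlinarith

lemma sub_eq_of_isAhead_of_isBehind {A : Plane} {φ ψ a b : ℝ} (h : IsAhead β A φ a)
    (h' : IsBehind β A ψ b) : β ψ - β φ = a • dir φ + b • dir ψ := by
  rw [eq_add_of_sub_eq h'.2.symm, h.2]; abel

lemma cross_dir_ahead {A : Plane} {φ ψ a b : ℝ} (h : IsAhead β A φ a)
    (h' : IsBehind β A ψ b) : cross (dir φ) (β ψ - β φ) = b * Real.sin (ψ - φ) := by
  rw [sub_eq_of_isAhead_of_isBehind h h', cross_add, cross_smul, cross_smul, cross_dir_dir,
    cross_dir_dir]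
  simp

lemma cross_dir_behind {A : Plane} {φ ψ a b : ℝ} (h : IsAhead β A φ a)
    (h' : IsBehind β A ψ b) : cross (dir ψ) (β φ - β ψ) = a * Real.sin (ψ - φ) := by
  rw [← neg_sub, sub_eq_of_isAhead_of_isBehind h h', ← neg_one_smul ℝ, cross_smul, cross_add,
    cross_smul, cross_smul, cross_dir_dir, cross_dir_dir, ← neg_sub ψ φ, Real.sin_neg]
  simp

lemma sin_pos (hβ : IsStrictlyConvexParam β) {A : Plane} {φ ψ a b : ℝ} (h : IsAhead β A φ a)
    (h' : IsBehind β A ψ b) : 0 < Real.sin (ψ - φ) := by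
  have hne : (φ : Real.Angle) ≠ ψ := by
    intro heq
    have h1 := sub_eq_of_isAhead_of_isBehind h h'
    rw [hβ.congr heq, sub_self, dir_congr heq, ← add_smul, eq_comm, smul_eq_zero] at h1
    rcases h1 with h1 | h1
    · linarith [h.1, h'.1]
    · have := norm_dir ψ
      rw [h1, norm_zero] at this
      exact zero_ne_one this
  have h1 := hβ.cross_pos φ ψ hne
  rw [cross_dir_ahead h h'] at h1
  exact (pos_iff_pos_of_mul_pos h1).1 h'.1

end IsStrictlyConvexParam

/-! ### One step of the outer length billiard -/

lemma abs_cross_dir_of_inner_eq_zero {θ : ℝ} {u : Plane} (h : inner ℝ (dir θ) u = 0) :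
    |cross (dir θ) u| = ‖u‖ := by
  have h' : Real.cos θ * u 0 + Real.sin θ * u 1 = 0 := by
    simpa [PiLp.inner_apply, Fin.sum_univ_two, mul_comm] using h
  rw [← abs_of_nonneg (norm_nonneg u), ← sq_eq_sq_iff_abs_eq_abs, norm_sq_plane, cross, dir_zero,
    dir_one]
  linear_combination (u 0 ^ 2 + u 1 ^ 2) * Real.sin_sq_add_cos_sq θ
    - (Real.cos θ * u 0 + Real.sin θ * u 1) * h'

lemma inner_dir_eq_zero_of_isTangentAt {S : EuclideanGeometry.Sphere Plane} {q p : Plane} {θ : ℝ}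
    (h : S.IsTangentAt p (AffineSubspace.mk' q (Submodule.span ℝ {dir θ}))) :
    inner ℝ (dir θ) (S.center - p) = 0 := by
  have hmem : p + dir θ ∈ AffineSubspace.mk' q (Submodule.span ℝ {dir θ}) := by
    have := AffineSubspace.vadd_mem_of_mem_direction (v := dir θ)
      (by rw [AffineSubspace.direction_mk']; exact Submodule.mem_span_singleton_self _) h.mem_space
    rwa [vadd_eq_add, add_comm] at this
  have := h.inner_left_eq_zero_of_mem hmem
  rw [vsub_eq_sub, vsub_eq_sub, add_sub_cancel_left] at this
  rw [← neg_sub, inner_neg_right, this, neg_zero]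

/-- The distance from the centre of a circle to a tangent line is the radius. -/
lemma abs_cross_of_isTangent {S : EuclideanGeometry.Sphere Plane} {q : Plane} {θ : ℝ}
    (h : S.IsTangent (AffineSubspace.mk' q (Submodule.span ℝ {dir θ}))) :
    |cross (dir θ) (S.center - q)| = S.radius := by
  obtain ⟨p, hp⟩ := h
  have h1 := abs_cross_dir_of_inner_eq_zero (inner_dir_eq_zero_of_isTangentAt hp)
  have h2 : ‖S.center - p‖ = S.radius := by
    rw [← dist_eq_norm, dist_comm]; exact hp.mem_sphere
  obtain ⟨t, ht⟩ := Submodule.mem_span_singleton.1 (AffineSubspace.mem_mk'.1 hp.mem_space)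
  have h3 : S.center - q = (S.center - p) + t • dir θ := by
    rw [ht, vsub_eq_sub]; abel
  rw [h3, cross_add, cross_smul, cross_dir_dir, sub_self, Real.sin_zero, mul_zero, add_zero, h1, h2]

/-- The centre of a circle of radius `r` that touches an oriented line from the right. -/
lemma exists_center_eq {S : EuclideanGeometry.Sphere Plane} {p : Plane} {ψ : ℝ}
    (h : S.IsTangentAt p (AffineSubspace.mk' p (Submodule.span ℝ {dir ψ})))
    (hneg : cross (dir ψ) (S.center - p) < 0) :
    0 < S.radius ∧ S.center = p + S.radius • dir (ψ - Real.pi / 2) := by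
  have h0 := inner_dir_eq_zero_of_isTangentAt h
  have h1 := abs_cross_of_isTangent ⟨p, h⟩
  rw [abs_of_neg hneg] at h1
  refine ⟨by linarith, ?_⟩
  rw [← sub_eq_iff_eq_add']
  apply eq_of_cross_dir_eq (θ := ψ)
  · rw [cross_smul, cross_dir_dir]
    simp only [sub_sub_cancel_left, Real.sin_neg, Real.sin_pi_div_two]
    linarith
  · rw [cross_smul, cross_dir_dir, sub_self, Real.sin_zero, mul_zero]
    have h' : Real.cos ψ * (S.center - p) 0 + Real.sin ψ * (S.center - p) 1 = 0 := by
      simpa [PiLp.inner_apply, Fin.sum_univ_two, mul_comm] using h0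
    simp only [cross, dir_zero, dir_one, Real.cos_sub_pi_div_two, Real.sin_sub_pi_div_two]
    linear_combination h'

/-- Let a circle of radius `r` touch the curve from outside at `β ψ`, and let it also touch another
tangent line of the curve, with direction angle `χ`. If this line meets the tangent line at `β ψ` at
the (signed) distance `s` ahead of `β ψ`, then `s = r * cot ((χ - ψ) / 2)`. -/
lemma IsStrictlyConvexParam.circle_relation {β : ℝ → Plane} (hβ : IsStrictlyConvexParam β)
    {A C : Plane} {ψ χ s u r : ℝ} (hne : (χ : Real.Angle) ≠ ψ) (h1 : A = β ψ + s • dir ψ)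
    (h2 : A = β χ - u • dir χ) (hr : 0 < r) (hC : C = β ψ + r • dir (ψ - Real.pi / 2))
    (htan : |cross (dir χ) (C - β χ)| = r) :
    s * Real.sin (χ - ψ) = r * (1 + Real.cos (χ - ψ)) ∧ 0 < s * Real.sin (χ - ψ) ∧
      0 < u * Real.sin (χ - ψ) := by
  have e1 : β χ - β ψ = s • dir ψ + u • dir χ := by
    rw [← sub_eq_zero, eq_add_of_sub_eq h2.symm, h1]; abel
  have e2 : β ψ - β χ = (-s) • dir ψ + (-u) • dir χ := by
    rw [← neg_sub, e1, neg_smul, neg_smul]; abel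
  have hs : Real.sin (ψ - χ) = -Real.sin (χ - ψ) := by rw [← Real.sin_neg, neg_sub]
  have p1 := hβ.cross_pos χ ψ hne
  have p2 := hβ.cross_pos ψ χ hne.symm
  rw [e2, cross_add, cross_smul, cross_smul, cross_dir_dir, cross_dir_dir, sub_self, Real.sin_zero,
    hs] at p1
  rw [e1, cross_add, cross_smul, cross_smul, cross_dir_dir, cross_dir_dir, sub_self,
    Real.sin_zero] at p2
  have hC' : C - β χ = (β ψ - β χ) + r • dir (ψ - Real.pi / 2) := by rw [hC]; abel
  have hsin : Real.sin (ψ - Real.pi / 2 - χ) = -Real.cos (χ - ψ) := by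
    rw [show ψ - Real.pi / 2 - χ = (ψ - χ) - Real.pi / 2 by ring, Real.sin_sub_pi_div_two,
      ← Real.cos_neg, neg_sub]
  rw [hC', cross_add, e2, cross_add, cross_smul, cross_smul, cross_smul, cross_dir_dir,
    cross_dir_dir, cross_dir_dir, sub_self, Real.sin_zero, hs, hsin] at htan
  refine ⟨?_, by linarith, by linarith⟩
  -- The negative sign would put the circle and the curve on different sides of the line.
  rcases abs_eq hr.le |>.1 htan with h | h
  · linarith
  · nlinarith [Real.cos_le_one (χ - ψ)]

lemma half_angle_formulas {P c b r : ℝ} (hP : 0 < P) (hb : 0 < b) (hr : 0 < r)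
    (h1 : P ^ 2 + c ^ 2 = 1) (h2 : b * P = r * (1 + c)) :
    P = 2 * b * r / (b ^ 2 + r ^ 2) ∧ c = (b ^ 2 - r ^ 2) / (b ^ 2 + r ^ 2) := by
  have hc : 0 < 1 + c := (pos_iff_pos_of_mul_pos (h2 ▸ mul_pos hb hP)).1 hr
  have hd : 0 < b ^ 2 + r ^ 2 := by positivity
  have h3 : (1 + c) * (b ^ 2 * (1 - c)) = (1 + c) * (r ^ 2 * (1 + c)) := by
    linear_combination (b * P + r * (1 + c)) * h2 - b ^ 2 * h1
  have h4 := mul_left_cancel₀ hc.ne' h3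
  have h5 : c = (b ^ 2 - r ^ 2) / (b ^ 2 + r ^ 2) := by
    rw [eq_div_iff hd.ne']; linear_combination -h4
  refine ⟨?_, h5⟩
  have h6 : b * P = b * (2 * b * r / (b ^ 2 + r ^ 2)) := by
    rw [h2, h5]; field_simp; ring
  exact mul_left_cancel₀ hb.ne' h6

/-- Only one tangent line of the curve, apart from the tangent line at `β ψ`, touches a given circle
and meets the tangent line at `β ψ` behind `β ψ`: the further away the meeting point is, the smaller
is the angle of vision of the curve and the larger is the supplement of the angle of vision of the
circle, while these two are equal if the second tangent line is common to both. -/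
lemma IsStrictlyConvexParam.eq_of_circle_relation {β : ℝ → Plane} (hβ : IsStrictlyConvexParam β)
    {A A' : Plane} {ψ φ χ a a' b b' r : ℝ} (hφ : IsAhead β A φ a) (hψ : IsBehind β A ψ b)
    (hχ : IsAhead β A' χ a') (hψ' : IsBehind β A' ψ b') (hr : 0 < r)
    (h1 : b * Real.sin (ψ - φ) = r * (1 + Real.cos (ψ - φ)))
    (h2 : b' * Real.sin (ψ - χ) = r * (1 + Real.cos (ψ - χ))) : (φ : Real.Angle) = χ := by
  have hP := hβ.sin_pos hφ hψ
  have hP' := hβ.sin_pos hχ hψ'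
  obtain ⟨f1, f2⟩ := half_angle_formulas hP hψ.1 hr (Real.sin_sq_add_cos_sq _) h1
  obtain ⟨f3, f4⟩ := half_angle_formulas hP' hψ'.1 hr (Real.sin_sq_add_cos_sq _) h2
  have hb := hψ.1
  have hb' := hψ'.1
  have hΔ : Real.sin (χ - φ) =
      2 * r * (b' - b) * (b * b' + r ^ 2) / ((b ^ 2 + r ^ 2) * (b' ^ 2 + r ^ 2)) := by
    rw [show χ - φ = (ψ - φ) - (ψ - χ) by ring, Real.sin_sub, f1, f2, f3, f4]
    field_simp
    ring
  have hpos : 0 < 2 * r * (b * b' + r ^ 2) / ((b ^ 2 + r ^ 2) * (b' ^ 2 + r ^ 2)) := by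
    positivity
  have hΔ' : Real.sin (χ - φ) =
      (b' - b) * (2 * r * (b * b' + r ^ 2) / ((b ^ 2 + r ^ 2) * (b' ^ 2 + r ^ 2))) := by
    rw [hΔ]; ring
  have e0 : β χ - β φ = (b - b') • dir ψ - a' • dir χ + a • dir φ := by
    rw [← sub_eq_of_eq_add hφ.2, ← sub_eq_of_eq_add hχ.2, sub_smul]
    rw [show b • dir ψ = β ψ - A by rw [hψ.2]; abel,
      show b' • dir ψ = β ψ - A' by rw [hψ'.2]; abel]
    abel
  have e1 := hβ.cross_nonneg φ χ
  have e2 := hβ.cross_nonneg χ φ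
  rw [← neg_sub, ← neg_one_smul ℝ, cross_smul] at e2
  rw [e0, cross_add, cross_sub, cross_smul, cross_smul, cross_smul, cross_dir_dir, cross_dir_dir,
    cross_dir_dir, sub_self, Real.sin_zero] at e1 e2
  rw [← neg_sub χ φ, Real.sin_neg] at e2
  have ha := hφ.1
  have ha' := hχ.1
  rcases lt_trichotomy b b' with h | h | h
  · have : 0 < Real.sin (χ - φ) := hΔ' ▸ mul_pos (sub_pos.2 h) hpos
    nlinarith
  · have g1 : Real.cos (ψ - φ) = Real.cos (ψ - χ) := by rw [f2, f4, h]
    have g2 : Real.sin (ψ - φ) = Real.sin (ψ - χ) := by rw [f1, f3, h]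
    have := Real.Angle.cos_sin_inj g1 g2
    rw [Real.Angle.coe_sub, Real.Angle.coe_sub] at this
    exact sub_right_injective this
  · have : Real.sin (χ - φ) < 0 := hΔ' ▸ mul_neg_of_neg_of_pos (sub_neg.2 h) hpos
    nlinarith

/-- One step `A ↦ A'` of the outer length billiard in terms of the tangent angle. The tangent
segments of `A` have direction angles `φ`, `ψ` and those of `A'` have direction angles `ψ`, `χ`.
With the angles `π - (ψ - φ)` and `π - (χ - ψ)` between the tangent segments, the last two equations
express the radius `r` of the auxiliary circle by the tangent segments at `β ψ` of `A` and `A'`. -/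
lemma exists_of_outerLengthBilliard {γ β : ℝ → Plane} {α : ℝ → ℝ} (hβ : IsStrictlyConvexParam β)
    (hγβ : ∀ t, γ t = β (α t)) (hdir : ∀ t, ∃ c : ℝ, 0 < c ∧ deriv γ t = c • dir (α t))
    {A A' : Plane} (h : OuterLengthBilliard γ A A') :
    ∃ φ ψ χ a b s u r : ℝ, IsAhead β A φ a ∧ IsBehind β A ψ b ∧ IsAhead β A' ψ s ∧
      IsBehind β A' χ u ∧ b * Real.sin (ψ - φ) = r * (1 + Real.cos (ψ - φ)) ∧
      s * Real.sin (χ - ψ) = r * (1 + Real.cos (χ - ψ)) := by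
  obtain ⟨-, x, x', x'', S, ⟨a₀, ha₀, hx⟩, ⟨b₀, hb₀, hx'⟩, ⟨hS', hS, hright⟩, hS'', hne', hne,
    hA', hA''⟩ := h
  have hline : ∀ t, tangentLine γ t = AffineSubspace.mk' (β (α t))
      (Submodule.span ℝ {dir (α t)}) := by
    intro t
    obtain ⟨c, hc, hV⟩ := hdir t
    rw [tangentLine, hγβ, hV, Submodule.span_singleton_smul_eq hc.ne'.isUnit]
  have hlineq : ∀ s t, ((α s : ℝ) : Real.Angle) = α t → tangentLine γ s = tangentLine γ t := by
    intro s t hst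
    rw [hline, hline, hβ.congr hst, dir_congr hst]
  obtain ⟨c, hc, hV⟩ := hdir x
  obtain ⟨c', hc', hV'⟩ := hdir x'
  rw [hV, smul_smul, hγβ] at hx
  rw [hV', smul_smul, hγβ] at hx'
  rw [hline] at hS' hS hS'' hA' hA''
  rw [hγβ] at hS' hright
  generalize hφe : α x = φ at *
  generalize hψe : α x' = ψ at *
  generalize hχe : α x'' = χ at *
  have hφ : IsAhead β A φ (a₀ * c) := ⟨mul_pos ha₀ hc, by
    rw [eq_add_of_sub_eq hx]; abel⟩
  have hψ : IsBehind β A ψ (b₀ * c') := ⟨mul_pos hb₀ hc', by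
    rw [← hx']; abel⟩
  have hψφ := hβ.sin_pos hφ hψ
  have hneg : cross (dir ψ) (S.center - β ψ) < 0 := by
    rw [hx', cross_smul_left] at hright
    have h2 : S.center - A = (S.center - β ψ) + (b₀ * c') • dir ψ := by rw [← hx']; abel
    rw [h2, cross_add, cross_smul, cross_dir_dir, sub_self, Real.sin_zero, mul_zero,
      add_zero] at hright
    by_contra! hge
    exact absurd hright (not_lt.2 (mul_nonneg hψ.1.le hge))
  obtain ⟨hr, hC⟩ := exists_center_eq hS' hneg
  obtain ⟨s, hs⟩ := Submodule.mem_span_singleton.1 (AffineSubspace.mem_mk'.1 hA')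
  obtain ⟨u, hu⟩ := Submodule.mem_span_singleton.1 (AffineSubspace.mem_mk'.1 hA'')
  rw [vsub_eq_sub] at hs hu
  have hsA : A' = β ψ + s • dir ψ := by rw [hs]; abel
  have huA : A' = β χ - (-u) • dir χ := by rw [neg_smul, hu]; abel
  have hneφψ : (φ : Real.Angle) ≠ ψ := by
    intro heq
    have := congrArg Real.Angle.sin (sub_eq_zero.2 heq.symm)
    rw [← Real.Angle.coe_sub, Real.Angle.sin_coe, Real.Angle.sin_zero] at this
    exact hψφ.ne' this
  have hneχψ : (χ : Real.Angle) ≠ ψ := fun heq => hne' (hlineq _ _ (by rw [hχe, hψe, heq]))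
  obtain ⟨r1, -, -⟩ := hβ.circle_relation (A := A) (u := -(a₀ * c)) (s := -(b₀ * c')) hneφψ
    (by rw [hψ.2, neg_smul, sub_eq_add_neg]) (by rw [hφ.2, neg_smul, sub_neg_eq_add]) hr hC
    (abs_cross_of_isTangent hS)
  obtain ⟨r2, r3, r4⟩ := hβ.circle_relation hneχψ hsA huA hr hC (abs_cross_of_isTangent hS'')
  rw [← neg_sub ψ φ, Real.sin_neg, Real.cos_neg, neg_mul_neg] at r1
  -- A common tangent line that meets the tangent line at `β ψ` behind `β ψ` is the one at `β φ`.
  have hspos : 0 < s := by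
    by_contra! hs0
    have hs0 : s < 0 := lt_of_le_of_ne hs0 (by rintro rfl; simp at r3)
    have hsin : Real.sin (χ - ψ) < 0 := by
      by_contra! hge; exact absurd r3 (not_lt.2 (mul_nonpos_of_nonpos_of_nonneg hs0.le hge))
    have hu0 : 0 < u := by
      by_contra! hge
      exact absurd r4 (not_lt.2 (mul_nonpos_of_nonneg_of_nonpos (by linarith) hsin.le))
    rw [← neg_sub ψ χ, Real.sin_neg, Real.cos_neg] at r2
    have := hβ.eq_of_circle_relation hφ hψ (A' := A') (a' := u) (b' := -s) (χ := χ)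
      ⟨hu0, by rw [huA, neg_smul, sub_neg_eq_add]⟩
      ⟨by linarith, by rw [hsA, neg_smul, sub_neg_eq_add]⟩ hr r1 (by linarith)
    exact hne (hlineq _ _ (by rw [hχe, hφe, this]))
  have hsin : 0 < Real.sin (χ - ψ) := (pos_iff_pos_of_mul_pos r3).1 hspos
  exact ⟨φ, ψ, χ, _, _, s, -u, _, hφ, hψ, ⟨hspos, hsA⟩,
    ⟨(pos_iff_pos_of_mul_pos r4).2 hsin, huA⟩, r1, r2⟩

/-! ### Estimates far away from the curve -/

namespace IsStrictlyConvexParam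

variable {β : ℝ → Plane}

lemma exists_norm_le (hβ : IsStrictlyConvexParam β) : ∃ M : ℝ, 0 < M ∧ ∀ θ, ‖β θ‖ ≤ M := by
  obtain ⟨M, hM, h⟩ := (hβ.periodic.compact_of_continuous Real.two_pi_pos.ne'
    hβ.continuous).isBounded.exists_pos_norm_le
  exact ⟨M, hM, fun θ => h _ (Set.mem_range_self θ)⟩

/-- The points of the curve whose tangent directions make an obtuse angle with a given tangent line
have a distance from this line that is bounded away from zero. -/
lemma exists_le_cross (hβ : IsStrictlyConvexParam β) :
    ∃ m : ℝ, 0 < m ∧ ∀ φ ψ, Real.cos (ψ - φ) ≤ 0 → m ≤ cross (dir φ) (β ψ - β φ) := by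
  set K : Set (ℝ × ℝ) := Set.Icc 0 (2 * Real.pi) ×ˢ Set.Icc 0 (2 * Real.pi) ∩
    {x | Real.cos (x.2 - x.1) ≤ 0} with hK
  have hKc : IsCompact K := (isCompact_Icc.prod isCompact_Icc).inter_right
    (isClosed_le (by fun_prop) continuous_const)
  have hKn : K.Nonempty := by
    have := Real.pi_pos
    exact ⟨(0, Real.pi), ⟨⟨⟨le_rfl, by linarith⟩, ⟨by linarith, by linarith⟩⟩, by simp⟩⟩
  have hβi : ∀ i, Continuous fun θ => β θ i := fun i =>
    (EuclideanSpace.proj (𝕜 := ℝ) i).continuous.comp hβ.continuous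
  have hF : Continuous fun x : ℝ × ℝ => cross (dir x.1) (β x.2 - β x.1) := by
    have hd : ∀ i, Continuous fun x : ℝ × ℝ => β x.2 i - β x.1 i := fun i =>
      ((hβi i).comp continuous_snd).sub ((hβi i).comp continuous_fst)
    exact ((Real.continuous_cos.comp continuous_fst).mul (hd 1)).sub
      ((Real.continuous_sin.comp continuous_fst).mul (hd 0))
  have hpos : ∀ φ ψ, Real.cos (ψ - φ) ≤ 0 → 0 < cross (dir φ) (β ψ - β φ) := by
    intro φ ψ h
    refine hβ.cross_pos φ ψ fun heq => ?_
    have := congrArg Real.Angle.cos (sub_eq_zero.2 heq.symm)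
    rw [← Real.Angle.coe_sub, Real.Angle.cos_coe, Real.Angle.cos_zero] at this
    linarith
  obtain ⟨x, hx, hmin⟩ := hKc.exists_isMinOn hKn hF.continuousOn
  refine ⟨_, hpos x.1 x.2 hx.2, fun φ ψ h => ?_⟩
  have hmod : ∀ u : ℝ, ∃ v ∈ Set.Icc 0 (2 * Real.pi), (v : Real.Angle) = u := by
    intro u
    obtain ⟨j, hj, -⟩ := existsUnique_add_zsmul_mem_Ico Real.two_pi_pos u 0
    rw [zero_add] at hj
    exact ⟨_, Set.Ico_subset_Icc_self hj, Real.Angle.angle_eq_iff_two_pi_dvd_sub.2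
      ⟨j, by rw [zsmul_eq_mul]; ring⟩⟩
  obtain ⟨φ', hφ', hφe⟩ := hmod φ
  obtain ⟨ψ', hψ', hψe⟩ := hmod ψ
  have hcos : Real.cos (ψ' - φ') = Real.cos (ψ - φ) := by
    rw [← Real.Angle.cos_coe, ← Real.Angle.cos_coe, Real.Angle.coe_sub, Real.Angle.coe_sub, hφe,
      hψe]
  have := hmin (show (φ', ψ') ∈ K from ⟨⟨hφ', hψ'⟩, hcos.trans_le h⟩)
  simpa only [Set.mem_ofPred_eq, hβ.congr hφe, hβ.congr hψe, dir_congr hφe] using this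

lemma cross_le (θ s t : ℝ) {M : ℝ} (hM : ∀ θ, ‖β θ‖ ≤ M) : cross (dir θ) (β t - β s) ≤ 2 * M :=
  (cross_dir_le _ _).trans ((norm_sub_le _ _).trans (by linarith [hM s, hM t]))

/-- One step of the billiard enlarges `1 + cos (ψ - φ) = 1 - cos (angle of vision)` at most by a
constant factor, as long as the angle of vision is not obtuse. -/
lemma one_add_cos_le {A A' : Plane} {M m φ ψ χ a b s u r : ℝ}
    (hM : ∀ θ, ‖β θ‖ ≤ M)
    (hm : ∀ φ ψ, Real.cos (ψ - φ) ≤ 0 → m ≤ cross (dir φ) (β ψ - β φ))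
    (hφ : IsAhead β A φ a) (hψ : IsBehind β A ψ b) (hψ' : IsAhead β A' ψ s)
    (hχ : IsBehind β A' χ u)
    (h1 : b * Real.sin (ψ - φ) = r * (1 + Real.cos (ψ - φ)))
    (h2 : s * Real.sin (χ - ψ) = r * (1 + Real.cos (χ - ψ))) (hcos : Real.cos (ψ - φ) ≤ 0) :
    m * (1 + Real.cos (χ - ψ)) ≤ 2 * M * (1 + Real.cos (ψ - φ)) := by
  have e1 := hm φ ψ hcos
  rw [cross_dir_ahead hφ hψ, h1] at e1
  have e2 := cross_le χ χ ψ hM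
  rw [cross_dir_behind hψ' hχ, h2] at e2
  have q1 : 0 ≤ 1 + Real.cos (ψ - φ) := by linarith [Real.neg_one_le_cos (ψ - φ)]
  have q2 : 0 ≤ 1 + Real.cos (χ - ψ) := by linarith [Real.neg_one_le_cos (χ - ψ)]
  calc m * (1 + Real.cos (χ - ψ)) ≤ r * (1 + Real.cos (ψ - φ)) * (1 + Real.cos (χ - ψ)) :=
        mul_le_mul_of_nonneg_right e1 q2
    _ = r * (1 + Real.cos (χ - ψ)) * (1 + Real.cos (ψ - φ)) := by ring
    _ ≤ 2 * M * (1 + Real.cos (ψ - φ)) := mul_le_mul_of_nonneg_right e2 q1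

/-- From a far away point, the curve is seen under a small angle. -/
lemma one_add_cos_le_of_far (hβ : IsStrictlyConvexParam β) {A : Plane} {M η φ ψ a b : ℝ}
    (hM0 : 0 < M) (hM : ∀ θ, ‖β θ‖ ≤ M) (hφ : IsAhead β A φ a) (hψ : IsBehind β A ψ b)
    (hη : 0 < η) (hA : 3 * M + 2 * M / η < ‖A‖) : 1 + Real.cos (ψ - φ) ≤ η := by
  have hb := hψ.1
  have ha := hφ.1
  have hAb : ‖A‖ ≤ M + b := by
    rw [hψ.2]
    refine (norm_sub_le _ _).trans (add_le_add (hM ψ) ?_)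
    rw [norm_smul, norm_dir, mul_one, Real.norm_of_nonneg hb.le]
  have hηM : 0 < 2 * M / η := by positivity
  have hb2 : 2 * M < b := by linarith
  have hbη : 2 * M ≤ η * b := by
    have : 2 * M / η ≤ b := by linarith
    rwa [div_le_iff₀ hη, mul_comm b] at this
  have e1 := cross_le φ φ ψ hM
  rw [cross_dir_ahead hφ hψ] at e1
  have e2 := cross_le (ψ - Real.pi / 2) φ ψ hM
  rw [sub_eq_of_isAhead_of_isBehind hφ hψ, cross_add, cross_smul, cross_smul, cross_dir_dir,
    cross_dir_dir, sub_sub_cancel, Real.sin_pi_div_two,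
    show φ - (ψ - Real.pi / 2) = Real.pi / 2 - (ψ - φ) by ring, Real.sin_pi_div_two_sub] at e2
  have hcos : Real.cos (ψ - φ) < 0 := by
    by_contra! h
    have := mul_nonneg ha.le h
    linarith
  set c := Real.cos (ψ - φ)
  set S := Real.sin (ψ - φ)
  have hsq : S ^ 2 + c ^ 2 = 1 := Real.sin_sq_add_cos_sq _
  have hc1 : -1 ≤ c := Real.neg_one_le_cos _
  have hSη : S ≤ η := by
    by_contra! h
    have := mul_lt_mul_of_pos_left h hb
    linarith
  have hS1 : S ≤ 1 := Real.sin_le_one _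
  have hS0 : 0 < S := hβ.sin_pos hφ hψ
  nlinarith

end IsStrictlyConvexParam

lemma exists_supplementary_angle {x : ℝ} (h : 0 < Real.sin x) :
    ∃ θ, 0 < θ ∧ θ < Real.pi ∧ (x : Real.Angle) = ((Real.pi - θ : ℝ) : Real.Angle) ∧
      Real.cos θ = -Real.cos x := by
  have hsq := Real.sin_sq_add_cos_sq x
  have h1 : -1 < Real.cos x := by nlinarith [Real.neg_one_le_cos x]
  have h2 : Real.cos x < 1 := by nlinarith [Real.cos_le_one x]
  have hc : Real.cos (Real.arccos (-Real.cos x)) = -Real.cos x :=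
    Real.cos_arccos (by linarith) (by linarith)
  refine ⟨Real.arccos (-Real.cos x), Real.arccos_pos.2 (by linarith), ?_, ?_, hc⟩
  · rw [← Real.arccos_neg_one]
    exact Real.arccos_lt_arccos le_rfl (by linarith) (by linarith)
  · refine Real.Angle.cos_sin_inj ?_ ?_
    · rw [Real.cos_pi_sub, hc, neg_neg]
    · rw [Real.sin_pi_sub, Real.sin_arccos, neg_sq]
      rw [show 1 - Real.cos x ^ 2 = Real.sin x ^ 2 by linear_combination hsq.symm, Real.sqrt_sq h.le]

/-- A direction that turns `k` times, by `π - θ` with angles `0 < θ < π / k`, does not return. -/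
lemma not_closed_of_small_angles {k : ℕ} (hk : 0 < k) {ψ θ : ℕ → ℝ}
    (hstep : ∀ i < k, ((ψ (i + 1) : ℝ) : Real.Angle) = ((ψ i + (Real.pi - θ i) : ℝ) : Real.Angle))
    (hpos : ∀ i < k, 0 < θ i) (hlt : ∀ i < k, θ i < Real.pi / k) :
    ((ψ k : ℝ) : Real.Angle) ≠ ψ 0 := by
  have hπ := Real.pi_pos
  have hsum : ∀ j ≤ k, ((ψ j : ℝ) : Real.Angle) =
      ((ψ 0 + ∑ i ∈ Finset.range j, (Real.pi - θ i) : ℝ) : Real.Angle) := by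
    intro j
    induction j with
    | zero => simp
    | succ j ih =>
      intro hj
      rw [hstep j hj, Real.Angle.coe_add, ih (by omega), Finset.sum_range_succ, ← add_assoc,
        Real.Angle.coe_add (_ + _)]
  intro h
  rw [hsum k le_rfl] at h
  obtain ⟨N, hN⟩ := Real.Angle.angle_eq_iff_two_pi_dvd_sub.1 h
  rw [add_sub_cancel_left, Finset.sum_sub_distrib, Finset.sum_const, Finset.card_range,
    nsmul_eq_mul] at hN
  have hne : (Finset.range k).Nonempty := ⟨0, Finset.mem_range.2 hk⟩
  have h1 : 0 < ∑ i ∈ Finset.range k, θ i :=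
    Finset.sum_pos (fun i hi => hpos i (Finset.mem_range.1 hi)) hne
  have h2 : ∑ i ∈ Finset.range k, θ i < Real.pi := by
    calc ∑ i ∈ Finset.range k, θ i < ∑ i ∈ Finset.range k, Real.pi / k :=
          Finset.sum_lt_sum_of_nonempty hne fun i hi => hlt i (Finset.mem_range.1 hi)
      _ = Real.pi := by
          rw [Finset.sum_const, Finset.card_range, nsmul_eq_mul]; field_simp
  have h3 : ∑ i ∈ Finset.range k, θ i = Real.pi * ((k - 2 * N : ℤ) : ℝ) := by
    push_cast; linarith
  rw [h3] at h1 h2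
  have h4 : (0 : ℝ) < ((k - 2 * N : ℤ) : ℝ) := (pos_iff_pos_of_mul_pos h1).1 hπ
  have h5 : ((k - 2 * N : ℤ) : ℝ) < 1 := by
    by_contra! hge
    have := mul_le_mul_of_nonneg_left hge hπ.le
    linarith
  have h6 : 0 < (k - 2 * N : ℤ) := by exact_mod_cast h4
  have h7 : (k - 2 * N : ℤ) < 1 := by exact_mod_cast h5
  omega

/-- For a billiard orbit that starts far away, the angles of vision stay small for `k` steps, while
the tangent segments turn by `π` minus the angle of vision in each step. -/
lemma exists_norm_zero_le_of_isPeriodicOrbit {γ β : ℝ → Plane} {α : ℝ → ℝ}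
    (hβ : IsStrictlyConvexParam β) (hγβ : ∀ t, γ t = β (α t))
    (hdir : ∀ t, ∃ c : ℝ, 0 < c ∧ deriv γ t = c • dir (α t)) {k : ℕ} (hk : 0 < k) :
    ∃ ρ : ℝ, 0 < ρ ∧ ∀ p, IsPeriodicOrbit γ k p → ‖p 0‖ ≤ ρ := by
  have hπ := Real.pi_pos
  have hk' : (0 : ℝ) < k := by exact_mod_cast hk
  obtain ⟨M, hM0, hM⟩ := hβ.exists_norm_le
  obtain ⟨m, hm0, hm⟩ := hβ.exists_le_cross
  set K : ℝ := 2 * M / m + 1 with hK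
  have hK1 : 1 ≤ K := by
    have : 0 < 2 * M / m := by positivity
    linarith
  have hcosk : 0 < 1 - Real.cos (Real.pi / k) := by
    have h1 : Real.cos (Real.pi / k) < Real.cos 0 :=
      Real.cos_lt_cos_of_nonneg_of_le_pi le_rfl
        (div_le_self hπ.le (by exact_mod_cast hk)) (by positivity)
    rw [Real.cos_zero] at h1
    linarith
  set ε : ℝ := min 1 ((1 - Real.cos (Real.pi / k)) / 2) with hε
  have hε0 : 0 < ε := lt_min one_pos (by linarith)
  have hKk : 0 < K ^ k := by positivity
  refine ⟨3 * M + 2 * M / (ε / K ^ k), by positivity, fun p hp => ?_⟩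
  by_contra! hfar
  choose φ ψ χ a b s u r hφ hψ hψ' hχ h1 h2 using fun i =>
    exists_of_outerLengthBilliard hβ hγβ hdir (hp.1 i)
  have hφs : ∀ i, ((φ (i + 1) : ℝ) : Real.Angle) = ψ i := fun i =>
    hβ.isAhead_unique (hφ (i + 1)) (hψ' i)
  have hψs : ∀ i, ((ψ (i + 1) : ℝ) : Real.Angle) = χ i := fun i =>
    hβ.isBehind_unique (hψ (i + 1)) (hχ i)
  have hcos : ∀ i, Real.cos (χ i - ψ i) = Real.cos (ψ (i + 1) - φ (i + 1)) := by
    intro i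
    rw [← Real.Angle.cos_coe, ← Real.Angle.cos_coe, Real.Angle.coe_sub, Real.Angle.coe_sub, hφs,
      hψs]
  have hq0 : ∀ i, 0 ≤ 1 + Real.cos (ψ i - φ i) := fun i => by
    linarith [Real.neg_one_le_cos (ψ i - φ i)]
  have hstep : ∀ i, 1 + Real.cos (ψ i - φ i) ≤ 1 →
      1 + Real.cos (ψ (i + 1) - φ (i + 1)) ≤ K * (1 + Real.cos (ψ i - φ i)) := by
    intro i hi
    have := IsStrictlyConvexParam.one_add_cos_le hM hm (hφ i) (hψ i) (hψ' i) (hχ i) (h1 i) (h2 i)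
      (by linarith)
    rw [hcos, ← le_div_iff₀' hm0] at this
    refine this.trans ?_
    rw [hK, mul_div_right_comm]
    exact mul_le_mul_of_nonneg_right (by linarith) (hq0 i)
  have hstart : 1 + Real.cos (ψ 0 - φ 0) ≤ ε / K ^ k :=
    hβ.one_add_cos_le_of_far hM0 hM (hφ 0) (hψ 0) (by positivity) hfar
  have hsmall : ∀ i ≤ k, 1 + Real.cos (ψ i - φ i) ≤ ε / K ^ k * K ^ i := by
    intro i
    induction i with
    | zero => intro _; simpa using hstart
    | succ i ih =>
      intro hi
      have h3 := ih (by omega)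
      have h4 : ε / K ^ k * K ^ i ≤ 1 := by
        rw [div_mul_eq_mul_div, div_le_one hKk]
        calc ε * K ^ i ≤ 1 * K ^ k := by
              gcongr
              · exact min_le_left _ _
              · omega
          _ = K ^ k := one_mul _
      calc _ ≤ K * (1 + Real.cos (ψ i - φ i)) := hstep i (h3.trans h4)
        _ ≤ K * (ε / K ^ k * K ^ i) := by gcongr
        _ = _ := by ring
  have hsmall' : ∀ i ≤ k, 1 + Real.cos (ψ i - φ i) < 1 - Real.cos (Real.pi / k) := by
    intro i hi
    calc _ ≤ ε / K ^ k * K ^ i := hsmall i hi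
      _ ≤ ε / K ^ k * K ^ k := by gcongr
      _ = ε := div_mul_cancel₀ _ hKk.ne'
      _ ≤ (1 - Real.cos (Real.pi / k)) / 2 := min_le_right _ _
      _ < _ := by linarith
  choose θ hθ0 hθπ hθe hθc using fun i =>
    exists_supplementary_angle (hβ.sin_pos (hφ (i + 1)) (hψ (i + 1)))
  have hk0 : p k = p 0 := by simpa using hp.2 0
  refine not_closed_of_small_angles hk (ψ := ψ) (θ := θ) (fun i _ => ?_) (fun i _ => hθ0 i)
    (fun i hi => ?_) (hβ.isBehind_unique (hψ k) (hk0 ▸ hψ 0))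
  · rw [Real.Angle.coe_add, ← hθe, Real.Angle.coe_sub, hφs, add_sub_cancel]
  · by_contra! hge
    have h3 := Real.cos_le_cos_of_nonneg_of_le_pi (by positivity) (hθπ i).le hge
    have h4 := hsmall' (i + 1) hi
    rw [hθc] at h3
    linarith

theorem theorem4p2 (γ : ℝ → Plane) (L : ℝ) (hγ : IsOval γ L) (k : ℕ) (hk : 0 < k) :
    ∃ ρ : ℝ, 0 < ρ ∧
      ¬ ∃ p : ℕ → Plane, IsPeriodicOrbit γ k p ∧ ∃ i, p i ∉ Metric.closedBall (0 : Plane) ρ := by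
  obtain ⟨α, β, n, hγβ, hdir, hβ⟩ := hγ.exists_tangentAngleParam
  obtain ⟨ρ, hρ, h⟩ := exists_norm_zero_le_of_isPeriodicOrbit hβ.isStrictlyConvexParam hγβ hdir hk
  refine ⟨ρ, hρ, ?_⟩
  rintro ⟨p, hp, i, hi⟩
  -- The orbit that starts at `p i` is periodic as well.
  have hshift : IsPeriodicOrbit γ k fun j => p (j + i) :=
    ⟨fun j => by simpa only [add_right_comm] using hp.1 (j + i),
      fun j => by simpa only [add_right_comm] using hp.2 (j + i)⟩
  exact hi (mem_closedBall_zero_iff.2 (by simpa using h _ hshift))
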